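/- Let $\kappa$ be a field and let $G$ be an infinite group. A function $\sigma:G\times G\to\kappa$ is a *factor set* of $G$ if there are a non-zero unital $\kappa$-algebra $R$ and a map $\Gamma:G\to R$ with $\Gamma(1)=1$ such that for all $g,h\in G$: - if $\sigma(g,h)=0$ then $\Gamma(g^{-1})\Gamma(gh)=0$ and $\Gamma(gh)\Gamma(h^{-1})=0$; - if $\Gamma(g)\Gamma(h)=0$ then $\sigma(g,h)=0$; - $\Gamma(g^{-1})\Gamma(g)\Gamma(h)=\sigma(g,h)\Gamma(g^{-1})\Gamma(gh)$ and $\Gamma(g)\Gamma(h)\Gamma(h^{-1})=\sigma(g,h)\Gamma(gh)\Gamma(h^{-1})$. It is *idempotent* if it takes values in $\{0,1\}$. Put $\operatorname{Null}(\sigma)=\{(x,y)\in G\times G:\sigma(x,y)=0\}$. Let $\kappa_{par}^{\sigma}G$ be the universal unital $\kappa$-algebra generated by symbols $[g]$ ($g\in G$) subject to $[1]=1$, $[g^{-1}][gh]=[gh][h^{-1}]=0$ whenever $\sigma(g,h)=0$, $[g^{-1}][g][h]=\sigma(g,h)[g^{-1}][gh]$ and $[g][h][h^{-1}]=\sigma(g,h)[gh][h^{-1}]$.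 Let $e_g^\sigma=\sigma(g,g^{-1})^{-1}[g][g^{-1}]$ if $\sigma(g,g^{-1})\ne 0$ and $e_g^\sigma=0$ otherwise. These elements are commuting idempotents; let $B^\sigma$ be the unital subalgebra which they generate. For $w\in B^\sigma$ put $\theta_g(w)=\sigma(g^{-1},g)^{-1}[g]w[g^{-1}]$ if $\sigma(g,g^{-1})\neq0$ and $\theta_g(w)=0$ otherwise, and $\Theta_g(w)=\theta_g(e^\sigma_{g^{-1}}w)$. Let $\hat B^\sigma\cong\operatorname{Spec}B^\sigma$ be the set of all unital $\kappa$-algebra homomorphisms $B^\sigma\to\kappa$, with the topology of pointwise convergence ($\kappa$ discrete). The *spectral partial action* $\hat\theta$ of $G$ on $\hat B^\sigma$ consists of the clopen sets $\hat D_g=\{f\in\hat B^\sigma: f(e_g^\sigma)=1\}$ and the homeomorphisms $\hat\theta_g:\hat D_{g^{-1}}\to\hat D_g$, $\hat\theta_g(f)=f\circ\Theta_{g^{-1}}$. It is *topologically free* if for every $g\neq 1$ the set $\{f\in\hat D_{g^{-1}}:\hat\theta_g(f)=f\}$ has empty interior in $\hat B^\sigma$. Let $\Omega=\{\xi\subseteq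 G:1\in\xi\}$ with the topology induced by the product topology of $\{0,1\}^G$. Write $B$ and $e_g$ for $B^{\sigma}$ and $e_g^\sigma$ in the case where $\sigma$ is the constant function $1$, and for $\xi\in\Omega$ let $f_\xi:B\to\kappa$ be the $\kappa$-algebra homomorphism with $f_\xi(e_g)=1$ if $g\in\xi$ and $f_\xi(e_g)=0$ if $g\notin\xi$. Let $\mathcal I_\sigma$ be the ideal of $B$ generated by the elements $e_se_{sg}e_{sgh}$ with $\sigma(g,h)=0$ and the elements $e_se_{sg}e_{sgh}e_{sght}$ with $\sigma(g,h)\sigma(gh,t)\neq\sigma(g,ht)\sigma(h,t)$, where $s,g,h,t\in G$. Let $\Omega_\sigma=\{\xi\in\Omega:\mathcal I_\sigma\subseteq\ker f_\xi\}$, with the subspace topology. **Corollary.** If $\sigma$ is an idempotent factor set of the infinite group $G$ and $|\operatorname{Null}(\sigma)|<|G|$, then $\Omega_\sigma$ has no isolated points, and the spectral partial action $\hat\theta$ is topologically free. -/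

import Mathlib

namespace PartialProj

universe u v w

section Basic

variable {κ : Type u} [Field κ] {G : Type v} [Group G]

/-- `Γ : G → R` is a partial projective `σ`-representation of the group `G` in the unital
`κ`-algebra `R`. -/
structure IsPartialProjRep (σ : G → G → κ) {R : Type w} [Ring R] [Algebra κ R]
    (Γ : G → R) : Prop where
  zero_left : ∀ g h, σ g h = 0 → Γ g⁻¹ * Γ (g * h) = 0
  zero_right : ∀ g h, σ g h = 0 → Γ (g * h) * Γ h⁻¹ = 0
  eq_zero : ∀ g h, Γ g * Γ h = 0 → σ g h = 0
  map_one : Γ 1 = 1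
  mul_left : ∀ g h, Γ g⁻¹ * Γ g * Γ h = σ g h • (Γ g⁻¹ * Γ (g * h))
  mul_right : ∀ g h, Γ g * Γ h * Γ h⁻¹ = σ g h • (Γ (g * h) * Γ h⁻¹)

/-- `σ` is a factor set of `G` over `κ`: the factor set of some partial projective
representation of `G` in a nonzero unital `κ`-algebra. (The universe of `R` is no restriction:
`R` may be replaced by the subalgebra generated by the image of `Γ`.) -/
def IsFactorSet (σ : G → G → κ) : Prop :=
  ∃ (R : Type (max u v)) (_ : Ring R) (_ : Algebra κ R) (_ : Nontrivial R) (Γ : G → R),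
    IsPartialProjRep σ Γ

/-- A factor set `σ` is idempotent if it takes values in `{0, 1}`. -/
def IsIdempotentFactorSet (σ : G → G → κ) : Prop :=
  IsFactorSet σ ∧ ∀ g h, σ g h = 0 ∨ σ g h = 1

/-- The zero set of `σ`. -/
def Null (σ : G → G → κ) : Set (G × G) := {p | σ p.1 p.2 = 0}

/-- The defining relations of the twisted partial group algebra. The relation `one` says that
the generator of the neutral element is the identity of the algebra. -/
inductive TwistedRel (σ : G → G → κ) : FreeAlgebra κ G → FreeAlgebra κ G → Prop
  | zero_left (g h : G) : σ g h = 0 →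
      TwistedRel σ (FreeAlgebra.ι κ g⁻¹ * FreeAlgebra.ι κ (g * h)) 0
  | zero_right (g h : G) : σ g h = 0 →
      TwistedRel σ (FreeAlgebra.ι κ (g * h) * FreeAlgebra.ι κ h⁻¹) 0
  | mul_left (g h : G) :
      TwistedRel σ (FreeAlgebra.ι κ g⁻¹ * FreeAlgebra.ι κ g * FreeAlgebra.ι κ h)
        (σ g h • (FreeAlgebra.ι κ g⁻¹ * FreeAlgebra.ι κ (g * h)))
  | mul_right (g h : G) :
      TwistedRel σ (FreeAlgebra.ι κ g * FreeAlgebra.ι κ h * FreeAlgebra.ι κ h⁻¹)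
        (σ g h • (FreeAlgebra.ι κ (g * h) * FreeAlgebra.ι κ h⁻¹))
  | one : TwistedRel σ (FreeAlgebra.ι κ 1) 1

/-- The twisted partial group algebra of `G` with respect to `σ`. -/
def TwistedAlg (σ : G → G → κ) : Type (max u v) := RingQuot (TwistedRel σ)

noncomputable instance (σ : G → G → κ) : Ring (TwistedAlg σ) :=
  inferInstanceAs (Ring (RingQuot (TwistedRel σ)))

noncomputable instance (σ : G → G → κ) : Algebra κ (TwistedAlg σ) :=
  inferInstanceAs (Algebra κ (RingQuot (TwistedRel σ)))

/-- The canonical generator `[g]` of the twisted partial group algebra. -/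
noncomputable def br (σ : G → G → κ) (g : G) : TwistedAlg σ :=
  RingQuot.mkAlgHom κ (TwistedRel σ) (FreeAlgebra.ι κ g)

section Relations

variable (σ : G → G → κ)

theorem br_one : br σ 1 = 1 := by
  have h := RingQuot.mkAlgHom_rel κ (TwistedRel.one (σ := σ))
  rw [_root_.map_one] at h
  exact h

theorem br_zero_left (g h : G) (H : σ g h = 0) : br σ g⁻¹ * br σ (g * h) = 0 := by
  have h := RingQuot.mkAlgHom_rel κ (TwistedRel.zero_left (σ := σ) g h H)
  rw [map_mul, map_zero] at h
  exact h

theorem br_zero_right (g h : G) (H : σ g h = 0) : br σ (g * h) * br σ h⁻¹ = 0 := by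
  have h := RingQuot.mkAlgHom_rel κ (TwistedRel.zero_right (σ := σ) g h H)
  rw [map_mul, map_zero] at h
  exact h

theorem br_mul_left (g h : G) :
    br σ g⁻¹ * br σ g * br σ h = σ g h • (br σ g⁻¹ * br σ (g * h)) := by
  have h := RingQuot.mkAlgHom_rel κ (TwistedRel.mul_left (σ := σ) g h)
  rw [map_smul, map_mul, map_mul, map_mul] at h
  exact h

theorem br_mul_right (g h : G) :
    br σ g * br σ h * br σ h⁻¹ = σ g h • (br σ (g * h) * br σ h⁻¹) := by
  have h := RingQuot.mkAlgHom_rel κ (TwistedRel.mul_right (σ := σ) g h)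
  rw [map_smul, map_mul, map_mul, map_mul] at h
  exact h

/-- Universal property of the twisted partial group algebra. -/
noncomputable def liftAlg {R : Type w} [Ring R] [Algebra κ R] (Γ : G → R)
    (hzl : ∀ g h, σ g h = 0 → Γ g⁻¹ * Γ (g * h) = 0)
    (hzr : ∀ g h, σ g h = 0 → Γ (g * h) * Γ h⁻¹ = 0)
    (hone : Γ 1 = 1)
    (hml : ∀ g h, Γ g⁻¹ * Γ g * Γ h = σ g h • (Γ g⁻¹ * Γ (g * h)))
    (hmr : ∀ g h, Γ g * Γ h * Γ h⁻¹ = σ g h • (Γ (g * h) * Γ h⁻¹)) :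
    TwistedAlg σ →ₐ[κ] R :=
  RingQuot.liftAlgHom κ ⟨FreeAlgebra.lift κ Γ, by
    intro x y hxy
    cases hxy with
    | zero_left g h H => simpa using hzl g h H
    | zero_right g h H => simpa using hzr g h H
    | mul_left g h => simpa using hml g h
    | mul_right g h => simpa using hmr g h
    | one => simpa using hone⟩

theorem liftAlg_br {R : Type w} [Ring R] [Algebra κ R] (Γ : G → R) (hzl hzr hone hml hmr)
    (g : G) : liftAlg σ Γ hzl hzr hone hml hmr (br σ g) = Γ g := by
  unfold liftAlg br
  exact (RingQuot.liftAlgHom_mkAlgHom_apply κ _ _ _).trans (FreeAlgebra.lift_ι_apply _ _)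

/-- The idempotent `e_g = σ(g, g⁻¹)⁻¹ [g][g⁻¹]` if `σ(g, g⁻¹) ≠ 0`, and `e_g = 0` otherwise. -/
noncomputable def idem (g : G) : TwistedAlg σ :=
  open Classical in
  if σ g g⁻¹ ≠ 0 then (σ g g⁻¹)⁻¹ • (br σ g * br σ g⁻¹) else 0

theorem br_eq_zero {g : G} (h : σ g g⁻¹ = 0) : br σ g = 0 := by
  have := br_zero_right σ g g⁻¹ h
  simpa [br_one] using this

theorem br_inv_eq_zero {g : G} (h : σ g g⁻¹ = 0) : br σ g⁻¹ = 0 := by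
  have := br_zero_left σ g g⁻¹ h
  simpa [br_one] using this

theorem idem_eq (g : G) : idem σ g = (σ g g⁻¹)⁻¹ • (br σ g * br σ g⁻¹) := by
  unfold idem
  split_ifs with h
  · rfl
  · rw [not_not] at h
    simp [h]

theorem br_mul_br_inv (g : G) : br σ g * br σ g⁻¹ = σ g g⁻¹ • idem σ g := by
  by_cases h : σ g g⁻¹ = 0
  · simp [h, br_eq_zero σ h]
  · rw [idem_eq, smul_inv_smul₀ h]

theorem br_inv_mul_idem (g : G) : br σ g⁻¹ * idem σ g = br σ g⁻¹ := by
  by_cases h : σ g g⁻¹ = 0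
  · simp [br_inv_eq_zero σ h]
  · rw [idem_eq, mul_smul_comm, ← mul_assoc, br_mul_left, mul_inv_cancel, br_one, mul_one,
      inv_smul_smul₀ h]

theorem idem_mul_br (g : G) : idem σ g * br σ g = br σ g := by
  by_cases h : σ g g⁻¹ = 0
  · simp [br_eq_zero σ h]
  · have := br_mul_right σ g g⁻¹
    rw [inv_inv, mul_inv_cancel, br_one, one_mul] at this
    rw [idem_eq, smul_mul_assoc, this, inv_smul_smul₀ h]

theorem br_mul_idem_inv (g : G) : br σ g * idem σ g⁻¹ = br σ g := by
  simpa using br_inv_mul_idem σ g⁻¹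

theorem idem_mul_self (g : G) : idem σ g * idem σ g = idem σ g := by
  conv_lhs => rw [idem_eq σ g]
  rw [smul_mul_assoc, mul_assoc, ← idem_eq, br_inv_mul_idem, ← idem_eq]

theorem idem_one : idem σ 1 = 1 := by
  simpa [br_one] using br_inv_mul_idem σ (1 : G)

theorem br_mul_idem (g h : G) : br σ g * idem σ h = idem σ (g * h) * br σ g := by
  have h1 : br σ g * idem σ h = ((σ h h⁻¹)⁻¹ * σ g h) • (br σ (g * h) * br σ h⁻¹) := by
    rw [idem_eq, mul_smul_comm, ← mul_assoc, br_mul_right, smul_smul]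
  have h2 : idem σ (g * h) * br σ g =
      ((σ (g * h) (g * h)⁻¹)⁻¹ * σ (g * h)⁻¹ g) • (br σ (g * h) * br σ h⁻¹) := by
    have := br_mul_left σ (g * h)⁻¹ g
    rw [inv_inv] at this
    rw [idem_eq, smul_mul_assoc, this, smul_smul]
    congr 3
    group
  calc br σ g * idem σ h = idem σ (g * h) * (br σ g * idem σ h) := by
        rw [h1, mul_smul_comm, ← mul_assoc, idem_mul_br]
    _ = (idem σ (g * h) * br σ g) * idem σ h := by rw [mul_assoc]
    _ = idem σ (g * h) * br σ g := by
        rw [h2, smul_mul_assoc, mul_assoc, br_inv_mul_idem]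

theorem idem_comm (g h : G) : idem σ g * idem σ h = idem σ h * idem σ g := by
  rw [idem_eq σ g, smul_mul_assoc, mul_assoc, br_mul_idem, ← mul_assoc, br_mul_idem,
    mul_inv_cancel_left, mul_assoc, mul_smul_comm]

theorem br_mul_br (g h : G) : br σ g * br σ h = σ g h • (idem σ g * br σ (g * h)) := by
  calc br σ g * br σ h = br σ g * (br σ h * idem σ h⁻¹) := by rw [br_mul_idem_inv]
    _ = br σ g * (idem σ h * br σ h) := by rw [br_mul_idem_inv, idem_mul_br]
    _ = (σ h h⁻¹)⁻¹ • (br σ g * br σ h * br σ h⁻¹ * br σ h) := by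
        rw [idem_eq]; simp only [mul_smul_comm, smul_mul_assoc, mul_assoc]
    _ = σ g h • (br σ (g * h) * ((σ h h⁻¹)⁻¹ • (br σ h⁻¹ * br σ h))) := by
        rw [br_mul_right]
        simp only [mul_smul_comm, smul_mul_assoc, mul_assoc]
        rw [smul_comm]
    _ = σ g h • (br σ (g * h) * idem σ h⁻¹) := by
        congr 2
        by_cases hz : σ h h⁻¹ = 0
        · rw [br_inv_eq_zero σ hz, idem_eq, br_inv_eq_zero σ hz]; simp
        · have h3 := br_mul_right σ h h⁻¹
          rw [inv_inv, mul_inv_cancel, br_one, one_mul] at h3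
          have h4 := br_inv_mul_idem σ h
          calc (σ h h⁻¹)⁻¹ • (br σ h⁻¹ * br σ h)
              = (σ h h⁻¹)⁻¹ • (idem σ h⁻¹ * br σ h⁻¹ * br σ h) := by rw [idem_mul_br]
            _ = (σ h⁻¹ h⁻¹⁻¹)⁻¹ • (br σ h⁻¹ * ((σ h h⁻¹)⁻¹ • (br σ h⁻¹⁻¹ * br σ h⁻¹ * br σ h))) := by
                rw [idem_eq σ h⁻¹]
                simp only [mul_smul_comm, smul_mul_assoc, mul_assoc]
                rw [smul_comm]
            _ = idem σ h⁻¹ := by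
                rw [inv_inv, h3, inv_smul_smul₀ hz, idem_eq, inv_inv]
    _ = σ g h • (idem σ g * br σ (g * h)) := by
        rw [br_mul_idem, mul_inv_cancel_right]

theorem br_mul_br_eq_right (g h : G) :
    br σ g * br σ h = σ g h • (br σ (g * h) * idem σ h⁻¹) := by
  rw [br_mul_idem, mul_inv_cancel_right, br_mul_br]

end Relations

section DiagonalAlgebra

variable (σ : G → G → κ)

/-- The subalgebra `B^σ` of the twisted partial group algebra generated by the idempotents
`e_g`. -/
noncomputable def diagAlg : Subalgebra κ (TwistedAlg σ) :=
  Algebra.adjoin κ (Set.range (idem σ))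

noncomputable instance : CommRing (diagAlg σ) :=
  { (diagAlg σ).toRing with
    mul_comm := (Algebra.isMulCommutative_adjoin κ (s := Set.range (idem σ)) (by
      rintro _ ⟨g, rfl⟩ _ ⟨h, rfl⟩
      exact idem_comm σ g h)).is_comm.comm }

/-- The generator `e_g` as an element of `B^σ`. -/
noncomputable def diagIdem (g : G) : diagAlg σ :=
  ⟨idem σ g, Algebra.subset_adjoin ⟨g, rfl⟩⟩

theorem exists_br_mul (g : G) {x : TwistedAlg σ} (hx : x ∈ diagAlg σ) :
    ∃ y ∈ diagAlg σ, br σ g * x = y * br σ g := by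
  unfold diagAlg at hx
  induction hx using Algebra.adjoin_induction with
  | mem x hx =>
    obtain ⟨h, rfl⟩ := hx
    exact ⟨idem σ (g * h), Algebra.subset_adjoin ⟨_, rfl⟩, br_mul_idem σ g h⟩
  | algebraMap r => exact ⟨algebraMap _ _ r, Subalgebra.algebraMap_mem _ r,
      (Algebra.commutes r _).symm⟩
  | add x y _ _ hx hy =>
    obtain ⟨a, ha, hxa⟩ := hx
    obtain ⟨b, hb, hyb⟩ := hy
    exact ⟨a + b, add_mem ha hb, by rw [mul_add, hxa, hyb, add_mul]⟩
  | mul x y _ _ hx hy =>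
    obtain ⟨a, ha, hxa⟩ := hx
    obtain ⟨b, hb, hyb⟩ := hy
    exact ⟨a * b, mul_mem ha hb, by rw [← mul_assoc, hxa, mul_assoc, hyb, mul_assoc]⟩

theorem diag_comm {x y : TwistedAlg σ} (hx : x ∈ diagAlg σ) (hy : y ∈ diagAlg σ) :
    x * y = y * x :=
  congrArg Subtype.val (mul_comm (⟨x, hx⟩ : diagAlg σ) ⟨y, hy⟩)

theorem idem_mem (g : G) : idem σ g ∈ diagAlg σ := Algebra.subset_adjoin ⟨g, rfl⟩

theorem conj_mem (g : G) (x : diagAlg σ) :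
    (σ g⁻¹ g)⁻¹ • (br σ g * (x : TwistedAlg σ) * br σ g⁻¹) ∈ diagAlg σ := by
  obtain ⟨y, hy, h⟩ := exists_br_mul σ g x.2
  rw [h, mul_assoc, br_mul_br_inv]
  exact Subalgebra.smul_mem _ (mul_mem hy (Subalgebra.smul_mem _ (idem_mem σ g) _)) _

/-- The map `θ_g(w) = σ(g⁻¹, g)⁻¹ [g] w [g⁻¹]` if `σ(g⁻¹, g) ≠ 0` (and `0` otherwise, by the
convention `0⁻¹ = 0`), on all of `B^σ`. -/
noncomputable def conj (g : G) (x : diagAlg σ) : diagAlg σ :=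
  ⟨(σ g⁻¹ g)⁻¹ • (br σ g * (x : TwistedAlg σ) * br σ g⁻¹), conj_mem σ g x⟩

/-- The map `Θ_g(w) = θ_g(e_{g⁻¹} w)` on `B^σ`. -/
noncomputable def bigTheta (g : G) (x : diagAlg σ) : diagAlg σ :=
  conj σ g (diagIdem σ g⁻¹ * x)

theorem bigTheta_eq_conj (g : G) (x : diagAlg σ) : bigTheta σ g x = conj σ g x := by
  apply Subtype.ext
  change (σ g⁻¹ g)⁻¹ • (br σ g * (idem σ g⁻¹ * (x : TwistedAlg σ)) * br σ g⁻¹) = _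
  rw [← mul_assoc (br σ g), br_mul_idem_inv]
  rfl

theorem sigma_inv_smul_br (g : G) :
    (σ g⁻¹ g)⁻¹ • br σ g = (σ g g⁻¹)⁻¹ • br σ g := by
  have h1 := br_mul_right σ g g⁻¹
  have h2 := br_mul_left σ g⁻¹ g
  rw [inv_inv, mul_inv_cancel, br_one, one_mul] at h1
  rw [inv_inv, inv_mul_cancel, br_one, mul_one] at h2
  have h3 : (σ g g⁻¹ - σ g⁻¹ g) • br σ g = 0 := by rw [sub_smul, ← h1, ← h2, sub_self]
  rcases smul_eq_zero.1 h3 with h | h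
  · rw [sub_eq_zero.1 h]
  · simp [h]

theorem conj_coe (g : G) (x : diagAlg σ) : (conj σ g x : TwistedAlg σ) =
    (σ g g⁻¹)⁻¹ • (br σ g * (x : TwistedAlg σ) * br σ g⁻¹) := by
  change (σ g⁻¹ g)⁻¹ • (br σ g * (x : TwistedAlg σ) * br σ g⁻¹) = _
  rw [← smul_mul_assoc, ← smul_mul_assoc, sigma_inv_smul_br, smul_mul_assoc, smul_mul_assoc]

theorem conj_mul (g : G) (x y : diagAlg σ) :
    conj σ g (x * y) = conj σ g x * conj σ g y := by
  apply Subtype.ext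
  have key : ((σ g⁻¹ g)⁻¹ • (br σ g⁻¹ * br σ g)) = idem σ g⁻¹ := by
    rw [idem_eq, inv_inv]
  have : (conj σ g x * conj σ g y : TwistedAlg σ) = (σ g⁻¹ g)⁻¹ • (br σ g * (x : TwistedAlg σ) *
      ((σ g⁻¹ g)⁻¹ • (br σ g⁻¹ * br σ g)) * y * br σ g⁻¹) := by
    change ((σ g⁻¹ g)⁻¹ • (br σ g * (x : TwistedAlg σ) * br σ g⁻¹)) *
      ((σ g⁻¹ g)⁻¹ • (br σ g * (y : TwistedAlg σ) * br σ g⁻¹)) = _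
    simp only [mul_smul_comm, smul_mul_assoc, mul_assoc]
  have e : idem σ g⁻¹ * (y : TwistedAlg σ) * br σ g⁻¹ = (y : TwistedAlg σ) * br σ g⁻¹ := by
    rw [diag_comm σ (idem_mem σ g⁻¹) y.2, mul_assoc, idem_mul_br]
  rw [Subalgebra.coe_mul, this, key]
  change (σ g⁻¹ g)⁻¹ • (br σ g * ((x : TwistedAlg σ) * y) * br σ g⁻¹) = _
  congr 1
  calc br σ g * ((x : TwistedAlg σ) * y) * br σ g⁻¹
      = br σ g * x * (idem σ g⁻¹ * (y : TwistedAlg σ) * br σ g⁻¹) := by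
        rw [e]; simp only [mul_assoc]
    _ = _ := by simp only [mul_assoc]

theorem conj_one (g : G) : conj σ g 1 = diagIdem σ g := by
  apply Subtype.ext
  rw [conj_coe]
  change (σ g g⁻¹)⁻¹ • (br σ g * 1 * br σ g⁻¹) = idem σ g
  rw [mul_one, idem_eq]

theorem conj_idem (g h : G) :
    conj σ g (diagIdem σ h) = diagIdem σ (g * h) * diagIdem σ g := by
  apply Subtype.ext
  rw [conj_coe]
  change (σ g g⁻¹)⁻¹ • (br σ g * idem σ h * br σ g⁻¹) = idem σ (g * h) * idem σ g
  rw [br_mul_idem, mul_assoc, idem_eq σ g, mul_smul_comm]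

theorem conj_conj_inv (g : G) (x : diagAlg σ) :
    conj σ g (conj σ g⁻¹ x) = diagIdem σ g * x := by
  apply Subtype.ext
  change (σ g⁻¹ g)⁻¹ • (br σ g * (conj σ g⁻¹ x : TwistedAlg σ) * br σ g⁻¹) =
    idem σ g * (x : TwistedAlg σ)
  rw [conj_coe, inv_inv]
  have h1 : (σ g⁻¹ g)⁻¹ • (br σ g * ((σ g⁻¹ g)⁻¹ • (br σ g⁻¹ * (x : TwistedAlg σ) * br σ g)) *
      br σ g⁻¹) = ((σ g⁻¹ g)⁻¹ • br σ g * br σ g⁻¹) * (x : TwistedAlg σ) *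
        ((σ g⁻¹ g)⁻¹ • br σ g * br σ g⁻¹) := by
    simp only [mul_smul_comm, smul_mul_assoc, mul_assoc]
  rw [h1, sigma_inv_smul_br, smul_mul_assoc, ← idem_eq, mul_assoc,
    diag_comm σ x.2 (idem_mem σ g), ← mul_assoc, idem_mul_self]

theorem conj_comp (g h : G) (x : diagAlg σ) :
    conj σ g (conj σ h x) = diagIdem σ g * conj σ (g * h) x := by
  obtain ⟨c, hc⟩ : ∃ c : κ, ∀ x : diagAlg σ,
      conj σ g (conj σ h x) = c • (diagIdem σ g * conj σ (g * h) x) := by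
    by_cases hz : σ (g * h) (g * h)⁻¹ = 0
    · refine ⟨0, fun x => Subtype.ext ?_⟩
      rw [conj_coe, conj_coe, zero_smul]
      have : br σ g * br σ h = 0 := by rw [br_mul_br, br_eq_zero σ hz]; simp
      rw [mul_smul_comm, ← mul_assoc, ← mul_assoc, this]
      simp
    · refine ⟨(σ g g⁻¹)⁻¹ * (σ h h⁻¹)⁻¹ * σ g h * σ h⁻¹ g⁻¹ * σ (g * h) (g * h)⁻¹,
        fun x => Subtype.ext ?_⟩
      have e1 : br σ h⁻¹ * br σ g⁻¹ = σ h⁻¹ g⁻¹ • (br σ (g * h)⁻¹ * idem σ g) := by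
        rw [br_mul_br_eq_right, inv_inv, mul_inv_rev]
      have e2 : (conj σ (g * h) x : TwistedAlg σ) * idem σ g =
          idem σ g * (conj σ (g * h) x : TwistedAlg σ) :=
        diag_comm σ (conj σ (g * h) x).2 (idem_mem σ g)
      have e3 : br σ (g * h) * (x : TwistedAlg σ) * br σ (g * h)⁻¹ =
          σ (g * h) (g * h)⁻¹ • (conj σ (g * h) x : TwistedAlg σ) := by
        rw [conj_coe, smul_inv_smul₀ hz]
      calc (conj σ g (conj σ h x) : TwistedAlg σ)
          = ((σ g g⁻¹)⁻¹ * (σ h h⁻¹)⁻¹) • ((br σ g * br σ h) * (x : TwistedAlg σ) *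
              (br σ h⁻¹ * br σ g⁻¹)) := by
            rw [conj_coe, conj_coe]
            simp only [mul_smul_comm, smul_mul_assoc, mul_assoc, smul_smul]
        _ = ((σ g g⁻¹)⁻¹ * (σ h h⁻¹)⁻¹ * σ g h * σ h⁻¹ g⁻¹) • (idem σ g *
              (br σ (g * h) * (x : TwistedAlg σ) * br σ (g * h)⁻¹) * idem σ g) := by
            rw [e1, br_mul_br]
            simp only [mul_smul_comm, smul_mul_assoc, mul_assoc, smul_smul]
            congr 1
            ring
        _ = _ := by
            rw [e3, mul_smul_comm, smul_mul_assoc, smul_smul, mul_assoc (idem σ g), e2,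
              ← mul_assoc (idem σ g), idem_mul_self]
            rfl
  have h1 := hc 1
  rw [conj_one, conj_idem, conj_one] at h1
  have h2 : conj σ (g * h) x = diagIdem σ (g * h) * conj σ (g * h) x := by
    rw [← conj_one, ← conj_mul, one_mul]
  rw [hc x, h2, ← mul_assoc, ← smul_mul_assoc, ← h1, mul_comm (diagIdem σ (g * h))]

end DiagonalAlgebra

end Basic

section TopologicalPartialAction

/-- A topological partial action of the group `G` on the topological space `X`. -/
structure TopPartialAction (G : Type v) [Group G] (X : Type w) [TopologicalSpace X] where
  dom : G → Set X
  isOpen_dom : ∀ g, IsOpen (dom g)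
  act : ∀ g, dom g⁻¹ ≃ₜ dom g
  dom_one : dom 1 = Set.univ
  act_one : ∀ x : dom 1⁻¹, (act 1 x : X) = x
  image_inter : ∀ g h, (fun x : dom g⁻¹ => (act g x : X)) '' {x | (x : X) ∈ dom h} =
    dom g ∩ dom (g * h)
  act_act : ∀ g h (x : X) (hx : x ∈ dom h⁻¹) (hx2 : x ∈ dom (g * h)⁻¹),
    ∃ hy : (act h ⟨x, hx⟩ : X) ∈ dom g⁻¹,
      (act g ⟨act h ⟨x, hx⟩, hy⟩ : X) = act (g * h) ⟨x, hx2⟩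

/-- The set of points of the domain of `θ_g` which are fixed by `θ_g`. -/
def TopPartialAction.fix {G : Type v} [Group G] {X : Type w} [TopologicalSpace X]
    (θ : TopPartialAction G X) (g : G) : Set X :=
  {x | ∃ hx : x ∈ θ.dom g⁻¹, (θ.act g ⟨x, hx⟩ : X) = x}

/-- A topological partial action is topologically free if for each `g ≠ 1` the set of the fixed
points of `θ_g` has empty interior. -/
def TopPartialAction.IsTopologicallyFree {G : Type v} [Group G] {X : Type w}
    [TopologicalSpace X] (θ : TopPartialAction G X) : Prop :=
  ∀ g : G, g ≠ 1 → interior (θ.fix g) = ∅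

end TopologicalPartialAction

section Spectral

variable {κ : Type u} [Field κ] {G : Type v} [Group G] (σ : G → G → κ)

/-- The spectrum of `B^σ`: the set of its (unital) `κ`-algebra homomorphisms to `κ`. -/
def Spectrum : Type (max u v) := diagAlg σ →ₐ[κ] κ

instance : FunLike (Spectrum σ) (diagAlg σ) κ :=
  inferInstanceAs (FunLike (diagAlg σ →ₐ[κ] κ) (diagAlg σ) κ)

instance : AlgHomClass (Spectrum σ) κ (diagAlg σ) κ :=
  inferInstanceAs (AlgHomClass (diagAlg σ →ₐ[κ] κ) κ (diagAlg σ) κ)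

/-- The topology of pointwise convergence, with `κ` discrete. -/
instance : TopologicalSpace (Spectrum σ) :=
  TopologicalSpace.induced (fun f x => f x)
    (@Pi.topologicalSpace (diagAlg σ) (fun _ => κ) (fun _ => ⊥))

/-- The set of the `f` with `f(e_g) = 1`. -/
def specDom (g : G) : Set (Spectrum σ) := {f | f (diagIdem σ g) = 1}

theorem isOpen_eval (x : diagAlg σ) (c : κ) : IsOpen {f : Spectrum σ | f x = c} := by
  let _ : TopologicalSpace κ := ⊥
  have : DiscreteTopology κ := ⟨rfl⟩
  have : Continuous (fun f : Spectrum σ => f x) :=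
    (continuous_apply x).comp continuous_induced_dom
  exact (isOpen_discrete {c}).preimage this

/-- The map `f ↦ f ∘ Θ_{g⁻¹}`. -/
noncomputable def specMap (g : G) (f : Spectrum σ) (hf : f ∈ specDom σ g⁻¹) : Spectrum σ :=
  show diagAlg σ →ₐ[κ] κ from
  AlgHom.ofLinearMap
    { toFun := fun x => f (bigTheta σ g⁻¹ x)
      map_add' := fun x y => by
        simp only [bigTheta_eq_conj]
        rw [← map_add]
        congr 1
        apply Subtype.ext
        simp [conj, mul_add, add_mul]
      map_smul' := fun c x => by
        simp only [bigTheta_eq_conj]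
        rw [RingHom.id_apply, ← map_smul]
        congr 1
        apply Subtype.ext
        simp [conj, smul_comm c] }
    (by
      change f (bigTheta σ g⁻¹ 1) = 1
      rw [bigTheta_eq_conj, conj_one]
      exact hf)
    (fun x y => by
      change f (bigTheta σ g⁻¹ (x * y)) = f (bigTheta σ g⁻¹ x) * f (bigTheta σ g⁻¹ y)
      rw [bigTheta_eq_conj, bigTheta_eq_conj, bigTheta_eq_conj, conj_mul, map_mul])

theorem specMap_apply (g : G) (f : Spectrum σ) (hf : f ∈ specDom σ g⁻¹) (x : diagAlg σ) :
    specMap σ g f hf x = f (bigTheta σ g⁻¹ x) := rfl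

theorem specMap_idem (g h : G) (f : Spectrum σ) (hf : f ∈ specDom σ g⁻¹) :
    specMap σ g f hf (diagIdem σ h) = f (diagIdem σ (g⁻¹ * h)) := by
  rw [specMap_apply, bigTheta_eq_conj, conj_idem, map_mul]
  have : f (diagIdem σ g⁻¹) = 1 := hf
  rw [this, mul_one]

theorem map_diagIdem_one (f : Spectrum σ) : f (diagIdem σ 1) = 1 := by
  have : diagIdem σ 1 = 1 := Subtype.ext (idem_one σ)
  rw [this, map_one]

theorem specMap_mem (g : G) (f : Spectrum σ) (hf : f ∈ specDom σ g⁻¹) :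
    specMap σ g f hf ∈ specDom σ g := by
  change specMap σ g f hf (diagIdem σ g) = 1
  rw [specMap_idem, inv_mul_cancel, map_diagIdem_one]

theorem spec_ext {f f' : Spectrum σ} (h : ∀ x, f x = f' x) : f = f' := DFunLike.ext _ _ h

theorem specMap_specMap (g h : G) (f : Spectrum σ) (hf : f ∈ specDom σ h⁻¹)
    (hf2 : f ∈ specDom σ (g * h)⁻¹) (hy : specMap σ h f hf ∈ specDom σ g⁻¹) :
    specMap σ g (specMap σ h f hf) hy = specMap σ (g * h) f hf2 := by
  apply spec_ext
  intro x
  have : f (diagIdem σ h⁻¹) = 1 := hf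
  simp only [specMap_apply, bigTheta_eq_conj]
  rw [conj_comp, map_mul, this, one_mul, mul_inv_rev]

theorem specMap_one (f : Spectrum σ) (hf : f ∈ specDom σ 1⁻¹) : specMap σ 1 f hf = f := by
  apply spec_ext
  intro x
  have h : conj σ (1 : G) (conj σ 1⁻¹ x) = diagIdem σ 1 * x := conj_conj_inv σ 1 x
  rw [conj_comp] at h
  have h1 : diagIdem σ (1 : G) = 1 := Subtype.ext (idem_one σ)
  rw [h1, one_mul, one_mul, one_mul] at h
  rw [specMap_apply, bigTheta_eq_conj, h]

theorem specMap_inv (g g' : G) (hg : g' * g = 1) (f : Spectrum σ) (hf : f ∈ specDom σ g⁻¹)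
    (hy : specMap σ g f hf ∈ specDom σ g'⁻¹) :
    specMap σ g' (specMap σ g f hf) hy = f := by
  have h1 : f ∈ specDom σ (g' * g)⁻¹ := by
    change f (diagIdem σ (g' * g)⁻¹) = 1
    rw [hg, inv_one, map_diagIdem_one]
  rw [specMap_specMap σ g' g f hf h1]
  apply spec_ext
  intro x
  have h2 : f ∈ specDom σ (1 : G)⁻¹ := by rw [← hg]; exact h1
  have := congrArg (fun F : Spectrum σ => F x) (specMap_one σ f h2)
  simp only [specMap_apply] at this ⊢
  rw [hg]
  exact this

theorem continuous_specMap (g : G) :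
    Continuous (fun f : specDom σ g⁻¹ => specMap σ g f.1 f.2) := by
  let _ : TopologicalSpace κ := ⊥
  have hc : ∀ y : diagAlg σ, Continuous (fun f : Spectrum σ => f y) := fun y =>
    (continuous_apply y).comp continuous_induced_dom
  exact continuous_induced_rng.2 (continuous_pi fun x =>
    (hc (bigTheta σ g⁻¹ x)).comp continuous_subtype_val)

/-- The homeomorphism `θ̂_g` given by `f ↦ f ∘ Θ_{g⁻¹}`. -/
noncomputable def specHomeo (g : G) : specDom σ g⁻¹ ≃ₜ specDom σ g where
  toFun f := ⟨specMap σ g f.1 f.2, specMap_mem σ g f.1 f.2⟩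
  invFun f := ⟨specMap σ g⁻¹ f.1 (by rw [inv_inv]; exact f.2),
    specMap_mem σ g⁻¹ f.1 (by rw [inv_inv]; exact f.2)⟩
  left_inv f := Subtype.ext (specMap_inv σ g g⁻¹ (inv_mul_cancel g) f.1 f.2
    (by rw [inv_inv]; exact specMap_mem σ g f.1 f.2))
  right_inv f := Subtype.ext (specMap_inv σ g⁻¹ g (mul_inv_cancel g) f.1
    (by rw [inv_inv]; exact f.2) (specMap_mem σ g⁻¹ f.1 (by rw [inv_inv]; exact f.2)))
  continuous_toFun := (continuous_specMap σ g).subtype_mk _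
  continuous_invFun := by
    refine Continuous.subtype_mk ?_ _
    have h : Continuous (fun f : specDom σ g =>
        (⟨f.1, by rw [inv_inv]; exact f.2⟩ : specDom σ g⁻¹⁻¹)) :=
      continuous_subtype_val.subtype_mk _
    exact (continuous_specMap σ g⁻¹).comp h

/-- The spectral partial action `θ̂` of `G` on the spectrum of `B^σ`. -/
noncomputable def spectralAction : TopPartialAction G (Spectrum σ) where
  dom := specDom σ
  isOpen_dom g := isOpen_eval σ _ _
  act := specHomeo σ
  dom_one := Set.eq_univ_of_forall fun f => map_diagIdem_one σ f
  act_one f := specMap_one σ f.1 f.2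
  image_inter g h := by
    ext f
    constructor
    · rintro ⟨f, hf, rfl⟩
      refine ⟨specMap_mem σ g f.1 f.2, ?_⟩
      change specMap σ g f.1 f.2 (diagIdem σ (g * h)) = 1
      rw [specMap_idem, inv_mul_cancel_left]
      exact hf
    · rintro ⟨h1, h2⟩
      have h1' : f ∈ specDom σ g⁻¹⁻¹ := by rw [inv_inv]; exact h1
      refine ⟨⟨specMap σ g⁻¹ f h1', specMap_mem σ g⁻¹ f h1'⟩, ?_,
        specMap_inv σ g⁻¹ g (mul_inv_cancel g) f h1' (specMap_mem σ g⁻¹ f h1')⟩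
      change specMap σ g⁻¹ f h1' (diagIdem σ h) = 1
      rw [specMap_idem, inv_inv]
      exact h2
  act_act g h f hf hf2 := by
    have hy : specMap σ h f hf ∈ specDom σ g⁻¹ := by
      change specMap σ h f hf (diagIdem σ g⁻¹) = 1
      rw [specMap_idem, ← mul_inv_rev]
      exact hf2
    exact ⟨hy, specMap_specMap σ g h f hf hf2 hy⟩

end Spectral

section Omega

variable (κ : Type u) [Field κ] {G : Type v} [Group G]

/-- The space `Ω` of all subsets of `G` which contain the neutral element. -/
def Omega (G : Type v) [Group G] : Type v := {ξ : Set G // (1 : G) ∈ ξ}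

/-- The topology induced by the product topology of `{0, 1}^G` by taking indicator functions. -/
noncomputable instance : TopologicalSpace (Omega G) :=
  TopologicalSpace.induced
    (fun ξ : Omega G => fun g : G => open Classical in decide (g ∈ ξ.1))
    (inferInstance : TopologicalSpace (G → Bool))

/-- The trivial factor set, whose algebra `B^1` is the algebra `B`. -/
def trivialFactorSet (G : Type v) : G → G → κ := fun _ _ => 1

/-- The operator `[g]` on functions on `ξ⁻¹ = {x | x⁻¹ ∈ ξ}`: translation by `g`, extended by
zero. It serves to build the homomorphism `f_ξ`. -/
noncomputable def shift (ξ : Set G) (g : G) :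
    Module.End κ ({x : G // x⁻¹ ∈ ξ} → κ) :=
  open Classical in
  { toFun := fun φ x => if h : (g⁻¹ * x.1)⁻¹ ∈ ξ then φ ⟨g⁻¹ * x.1, h⟩ else 0
    map_add' := fun φ ψ => by
      ext x
      by_cases h : (g⁻¹ * x.1)⁻¹ ∈ ξ <;>
        simp only [h, dif_pos, dif_neg, not_false_eq_true, Pi.add_apply, add_zero]
    map_smul' := fun c φ => by
      ext x
      by_cases h : (g⁻¹ * x.1)⁻¹ ∈ ξ <;>
        simp only [h, dif_pos, dif_neg, not_false_eq_true, Pi.smul_apply, smul_zero,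
          RingHom.id_apply] }

theorem shift_apply_of_mem {ξ : Set G} {g : G} (φ : {x : G // x⁻¹ ∈ ξ} → κ)
    (x : {x : G // x⁻¹ ∈ ξ}) (h : (g⁻¹ * x.1)⁻¹ ∈ ξ) :
    shift κ ξ g φ x = φ ⟨g⁻¹ * x.1, h⟩ :=
  dif_pos h

theorem shift_apply_of_not_mem {ξ : Set G} {g : G} (φ : {x : G // x⁻¹ ∈ ξ} → κ)
    (x : {x : G // x⁻¹ ∈ ξ}) (h : (g⁻¹ * x.1)⁻¹ ∉ ξ) :
    shift κ ξ g φ x = 0 :=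
  dif_neg h

theorem shift_mul_left (ξ : Set G) (g h : G) :
    shift κ ξ g⁻¹ * shift κ ξ g * shift κ ξ h = shift κ ξ g⁻¹ * shift κ ξ (g * h) := by
  ext φ x
  simp only [Module.End.mul_apply]
  by_cases h1 : (g⁻¹⁻¹ * x.1)⁻¹ ∈ ξ
  · rw [shift_apply_of_mem κ _ _ h1, shift_apply_of_mem κ _ _ h1]
    have h2 : (g⁻¹ * (g⁻¹⁻¹ * x.1))⁻¹ ∈ ξ := by simpa using x.2
    rw [shift_apply_of_mem κ _ _ h2]
    have e : h⁻¹ * (g⁻¹ * (g⁻¹⁻¹ * x.1)) = (g * h)⁻¹ * (g⁻¹⁻¹ * x.1) := by group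
    by_cases h3 : (h⁻¹ * (g⁻¹ * (g⁻¹⁻¹ * x.1)))⁻¹ ∈ ξ
    · rw [shift_apply_of_mem κ _ _ h3, shift_apply_of_mem κ _ _ (by rw [← e]; exact h3)]
      congr 2
    · rw [shift_apply_of_not_mem κ _ _ h3, shift_apply_of_not_mem κ _ _ (by rw [← e]; exact h3)]
  · rw [shift_apply_of_not_mem κ _ _ h1, shift_apply_of_not_mem κ _ _ h1]

theorem shift_mul_right (ξ : Set G) (g h : G) :
    shift κ ξ g * shift κ ξ h * shift κ ξ h⁻¹ = shift κ ξ (g * h) * shift κ ξ h⁻¹ := by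
  ext φ x
  simp only [Module.End.mul_apply]
  have e1 : h⁻¹ * (g⁻¹ * x.1) = (g * h)⁻¹ * x.1 := by group
  have e3 : h⁻¹⁻¹ * ((g * h)⁻¹ * x.1) = g⁻¹ * x.1 := by group
  by_cases h1 : (g⁻¹ * x.1)⁻¹ ∈ ξ
  · rw [shift_apply_of_mem κ _ x h1]
    by_cases h2 : (h⁻¹ * (g⁻¹ * x.1))⁻¹ ∈ ξ
    · have h4 : (h⁻¹⁻¹ * (h⁻¹ * (g⁻¹ * x.1)))⁻¹ ∈ ξ := by rw [e1, e3]; exact h1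
      have h5 : ((g * h)⁻¹ * x.1)⁻¹ ∈ ξ := by rw [← e1]; exact h2
      have h6 : (h⁻¹⁻¹ * ((g * h)⁻¹ * x.1))⁻¹ ∈ ξ := by rw [e3]; exact h1
      rw [shift_apply_of_mem κ _ _ h2, shift_apply_of_mem κ _ _ h4,
        shift_apply_of_mem κ _ x h5, shift_apply_of_mem κ _ _ h6]
      congr 1
      exact Subtype.ext (congrArg (h⁻¹⁻¹ * ·) e1)
    · rw [shift_apply_of_not_mem κ _ _ h2,
        shift_apply_of_not_mem κ _ x (by rw [← e1]; exact h2)]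
  · rw [shift_apply_of_not_mem κ _ x h1]
    by_cases h2 : ((g * h)⁻¹ * x.1)⁻¹ ∈ ξ
    · rw [shift_apply_of_mem κ _ x h2,
        shift_apply_of_not_mem κ _ _ (by
          change (h⁻¹⁻¹ * ((g * h)⁻¹ * x.1))⁻¹ ∉ ξ
          rw [e3]; exact h1)]
    · rw [shift_apply_of_not_mem κ _ x h2]

theorem shift_one (ξ : Set G) : shift κ ξ (1 : G) = 1 := by
  ext φ x
  have e : (1 : G)⁻¹ * x.1 = x.1 := by group
  rw [shift_apply_of_mem κ _ _ (by rw [e]; exact x.2)]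
  simp

/-- The action of the partial group algebra on the functions on `ξ⁻¹`. -/
noncomputable def shiftHom (ξ : Set G) :
    TwistedAlg (trivialFactorSet κ G) →ₐ[κ] Module.End κ ({x : G // x⁻¹ ∈ ξ} → κ) :=
  liftAlg _ (shift κ ξ) (fun _ _ H => absurd H one_ne_zero) (fun _ _ H => absurd H one_ne_zero)
    (shift_one κ ξ) (fun g h => by simp [trivialFactorSet, shift_mul_left])
    (fun g h => by simp [trivialFactorSet, shift_mul_right])

theorem shiftHom_idem_apply (ξ : Set G) (g : G) (φ : {x : G // x⁻¹ ∈ ξ} → κ)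
    (x : {x : G // x⁻¹ ∈ ξ}) :
    shiftHom κ ξ (idem (trivialFactorSet κ G) g) φ x =
      (open Classical in if (g⁻¹ * x.1)⁻¹ ∈ ξ then 1 else 0) * φ x := by
  have h0 : shiftHom κ ξ (idem (trivialFactorSet κ G) g) = shift κ ξ g * shift κ ξ g⁻¹ := by
    rw [idem_eq]
    have : trivialFactorSet κ G g g⁻¹ = 1 := rfl
    rw [this, inv_one, one_smul, map_mul]
    unfold shiftHom
    rw [liftAlg_br, liftAlg_br]
  rw [h0, Module.End.mul_apply]
  by_cases h : (g⁻¹ * x.1)⁻¹ ∈ ξ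
  · have e : g⁻¹⁻¹ * (g⁻¹ * x.1) = x.1 := by group
    rw [shift_apply_of_mem κ _ _ h, shift_apply_of_mem κ _ _ (by rw [e]; exact x.2), if_pos h,
      one_mul]
    congr 1
    exact Subtype.ext e
  · rw [shift_apply_of_not_mem κ _ _ h, if_neg h, zero_mul]

theorem shiftHom_diag (ξ : Set G) {b : TwistedAlg (trivialFactorSet κ G)}
    (hb : b ∈ diagAlg (trivialFactorSet κ G)) :
    ∃ d : {x : G // x⁻¹ ∈ ξ} → κ, ∀ φ x, shiftHom κ ξ b φ x = d x * φ x := by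
  unfold diagAlg at hb
  induction hb using Algebra.adjoin_induction with
  | mem b hb =>
    obtain ⟨g, rfl⟩ := hb
    exact ⟨_, fun φ x => shiftHom_idem_apply κ ξ g φ x⟩
  | algebraMap r =>
    exact ⟨fun _ => r, fun φ x => by rw [AlgHom.commutes, Module.algebraMap_end_apply]; rfl⟩
  | add a b _ _ ha hb =>
    obtain ⟨d, hd⟩ := ha
    obtain ⟨d', hd'⟩ := hb
    exact ⟨d + d', fun φ x => by
      rw [map_add, LinearMap.add_apply, Pi.add_apply, hd, hd', Pi.add_apply, add_mul]⟩
  | mul a b _ _ ha hb =>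
    obtain ⟨d, hd⟩ := ha
    obtain ⟨d', hd'⟩ := hb
    exact ⟨d * d', fun φ x => by
      rw [map_mul, Module.End.mul_apply, hd, hd', Pi.mul_apply, mul_assoc]⟩

/-- The homomorphism `f_ξ : B → κ` with `f_ξ(e_g) = 1` if `g ∈ ξ` and `f_ξ(e_g) = 0`
otherwise (see `pointHom_diagIdem`). It takes `b` to the value of `b · 1` at the neutral
element. -/
noncomputable def pointHom (ξ : Omega G) : diagAlg (trivialFactorSet κ G) →ₐ[κ] κ :=
  have h1 : (1 : G)⁻¹ ∈ ξ.1 := by rw [inv_one]; exact ξ.2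
  AlgHom.ofLinearMap
    { toFun := fun b => shiftHom κ ξ.1 b.1 (fun _ => 1) ⟨1, h1⟩
      map_add' := fun a b => by simp
      map_smul' := fun c b => by simp }
    (by simp)
    (fun a b => by
      obtain ⟨d, hd⟩ := shiftHom_diag κ ξ.1 a.2
      simp only [LinearMap.coe_mk, AddHom.coe_mk, Subalgebra.coe_mul, map_mul,
        Module.End.mul_apply]
      rw [hd, hd, mul_one])

theorem pointHom_diagIdem (ξ : Omega G) (g : G) :
    pointHom κ ξ (diagIdem (trivialFactorSet κ G) g) =
      (open Classical in if g ∈ ξ.1 then 1 else 0) := by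
  refine (shiftHom_idem_apply κ ξ.1 g _ _).trans ?_
  have e : (g⁻¹ * (1 : G))⁻¹ = g := by group
  rw [mul_one]
  congr 1
  exact congrArg (· ∈ ξ.1) e

variable {κ}

/-- The ideal `I_σ` of `B`. -/
noncomputable def sigmaIdeal (σ : G → G → κ) : Ideal (diagAlg (trivialFactorSet κ G)) :=
  let e : G → diagAlg (trivialFactorSet κ G) := diagIdem (trivialFactorSet κ G)
  Ideal.span
    ({b | ∃ s g h : G, σ g h = 0 ∧ b = e s * e (s * g) * e (s * g * h)} ∪
     {b | ∃ s g h t : G, σ g h * σ (g * h) t ≠ σ g (h * t) * σ h t ∧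
        b = e s * e (s * g) * e (s * g * h) * e (s * g * h * t)})

/-- The subspace `Ω_σ` of `Ω`. -/
def OmegaSigma (σ : G → G → κ) : Set (Omega G) :=
  {ξ | sigmaIdeal σ ≤ RingHom.ker (pointHom κ ξ)}

end Omega

end PartialProj

/-! Both claims reduce to the combinatorics of one family of subsets of `G`. Call a set `ξ`
containing `1` admissible if `σ (a⁻¹ * b) (b⁻¹ * c) ≠ 0` for all `a, b, c ∈ ξ`. For idempotent `σ`
these sets are exactly the points of `Ω_σ` (`mem_omegaSigma_iff`). They are also exactly the
supports `{g | f (e_g) = 1}` of the characters `f` of `B^σ`: supports are admissible by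
`Spectrum.isAdmissible_support`, and every admissible set occurs by `IsAdmissible.exists_spectrum`.
In both spaces, a neighbourhood of a point contains all points whose sets agree with the given one
on some finite `F ⊆ G`.

The heart is `IsAdmissible.exists_perturbation`: for every finite `F`, the membership of exactly one
point outside `F` can be changed without losing admissibility. An infinite `ξ` can lose a point,
because admissibility passes to subsets containing `1`. A finite `ξ` can gain a point: a new point
`x` is excluded only by finitely many conditions `σ (p x).1 (p x).2 = 0` with `p` injective, each of
which holds for at most `|Null σ| < |G|` values of `x`.

Hence no point of `Ω_σ` is isolated. If `f` were interior to the fixed set of `g ≠ 1`, then its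
support and a perturbation of it at some `x` would both be invariant under left translation by `g`.
They agree at `g * x ≠ x`, so by invariance they agree at `x`, a contradiction. -/

namespace PartialProj

universe u v

/-! ### Admissible sets and their one-point perturbations -/

section Admissible

variable {κ : Type u} [Field κ] {G : Type v} [Group G]

/-- A set `ξ` containing the neutral element is admissible if `σ (a⁻¹ * b) (b⁻¹ * c)` does not
vanish for `a, b, c ∈ ξ`. -/
structure IsAdmissible (σ : G → G → κ) (ξ : Set G) : Prop where
  one_mem : (1 : G) ∈ ξ
  ne_zero : ∀ a ∈ ξ, ∀ b ∈ ξ, ∀ c ∈ ξ, σ (a⁻¹ * b) (b⁻¹ * c) ≠ 0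

theorem IsAdmissible.ne_zero_of_mem {σ : G → G → κ} {ξ : Set G} (hξ : IsAdmissible σ ξ)
    {s g h : G} (h1 : s ∈ ξ) (h2 : s * g ∈ ξ) (h3 : s * g * h ∈ ξ) : σ g h ≠ 0 := by
  simpa [mul_assoc] using hξ.ne_zero _ h1 _ h2 _ h3

/-- If `σ 1 1` were zero, the vanishing relation at `(1, 1)` would read `1 * 1 = 0` in a nonzero
ring. This settles the triples `a = b = c` in the admissibility condition. -/
theorem IsFactorSet.one_one_ne_zero {σ : G → G → κ} (hσ : IsFactorSet σ) : σ 1 1 ≠ 0 := by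
  obtain ⟨R, _, _, _, Γ, hΓ⟩ := hσ
  intro h
  have := hΓ.zero_left 1 1 h
  simp [hΓ.map_one] at this

/-- The union is finite and `c` is infinite, so no regularity of `c` is needed. -/
theorem mk_biUnion_lt {α ι : Type v} {c : Cardinal.{v}} (hc : Cardinal.aleph0 ≤ c) {I : Set ι}
    (hI : I.Finite) {s : ι → Set α} (hs : ∀ i ∈ I, Cardinal.mk (s i) < c) :
    Cardinal.mk (⋃ i ∈ I, s i : Set α) < c := by
  induction I, hI using Set.Finite.induction_on with
  | empty => simpa using Cardinal.aleph0_pos.trans_le hc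
  | insert _ _ ih =>
    rw [Set.biUnion_insert]
    exact (Cardinal.mk_union_le _ _).trans_lt (Cardinal.add_lt_of_lt hc
      (hs _ (Set.mem_insert _ _)) (ih fun i hi => hs i (Set.mem_insert_of_mem _ hi)))

/-- The map `p` embeds the set of these `x` into the zero set of `σ`. -/
theorem mk_zeros_lt {G : Type v} {σ : G → G → κ} (hcard : Cardinal.mk {p : G × G | σ p.1 p.2 = 0} < Cardinal.mk G)
    {p : G → G × G} (hp : Function.Injective p) :
    Cardinal.mk {x | σ (p x).1 (p x).2 = 0} < Cardinal.mk G :=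
  (Cardinal.mk_le_of_injective (f := fun x : {x | σ (p x).1 (p x).2 = 0} =>
    (⟨p x.1, x.2⟩ : {p : G × G | σ p.1 p.2 = 0})) fun _ _ h => Subtype.ext (hp (congrArg Subtype.val h))).trans_lt hcard

/-- A finite admissible set has an admissible extension by one point outside a given finite
set. -/
theorem IsAdmissible.exists_insert [Infinite G] {σ : G → G → κ} (h11 : σ 1 1 ≠ 0)
    (hcard : Cardinal.mk (Null σ) < Cardinal.mk G) {ξ : Set G} (hξ : IsAdmissible σ ξ)
    (hfin : ξ.Finite) {F : Set G} (hF : F.Finite) :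
    ∃ x, x ∉ F ∧ x ∉ ξ ∧ IsAdmissible σ (insert x ξ) := by
  have hinf : Cardinal.aleph0 ≤ Cardinal.mk G := Cardinal.aleph0_le_mk G
  -- The six sets match the six ways in which a triple from `insert x ξ` can contain both `x` and a
  -- point of `ξ`. Where only one old point occurs, it is `p.1`, and the diagonal pairs of `ξ ×ˢ ξ`
  -- suffice.
  let bad : G × G → Set G := fun p =>
    {x | σ (x⁻¹ * x) (x⁻¹ * p.1) = 0} ∪ {x | σ (x⁻¹ * p.1) (p.1⁻¹ * x) = 0} ∪
    {x | σ (p.1⁻¹ * x) (x⁻¹ * x) = 0} ∪ {x | σ (x⁻¹ * p.1) (p.1⁻¹ * p.2) = 0} ∪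
    {x | σ (p.1⁻¹ * x) (x⁻¹ * p.2) = 0} ∪ {x | σ (p.1⁻¹ * p.2) (p.2⁻¹ * x) = 0}
  have hbad : ∀ p ∈ ξ ×ˢ ξ, Cardinal.mk (bad p) < Cardinal.mk G := by
    intro p _
    have hunion : ∀ {s t : Set G}, Cardinal.mk s < Cardinal.mk G →
        Cardinal.mk t < Cardinal.mk G → Cardinal.mk (s ∪ t : Set G) < Cardinal.mk G :=
      fun hs ht => (Cardinal.mk_union_le _ _).trans_lt (Cardinal.add_lt_of_lt hinf hs ht)
    -- In each of the six pairs at least one coordinate is an injective function of `x`.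
    refine hunion (hunion (hunion (hunion (hunion ?_ ?_) ?_) ?_) ?_) ?_
    · exact mk_zeros_lt hcard (p := fun x => (x⁻¹ * x, x⁻¹ * p.1)) fun x y h => by simpa using h
    · exact mk_zeros_lt hcard (p := fun x => (x⁻¹ * p.1, p.1⁻¹ * x)) fun x y h => by simpa using h
    · exact mk_zeros_lt hcard (p := fun x => (p.1⁻¹ * x, x⁻¹ * x)) fun x y h => by simpa using h
    · exact mk_zeros_lt hcard (p := fun x => (x⁻¹ * p.1, p.1⁻¹ * p.2)) fun x y h => by
        simpa using h
    · exact mk_zeros_lt hcard (p := fun x => (p.1⁻¹ * x, x⁻¹ * p.2)) fun x y h => by simpa using h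
    · exact mk_zeros_lt hcard (p := fun x => (p.1⁻¹ * p.2, p.2⁻¹ * x)) fun x y h => by
        simpa using h
  have hlt : Cardinal.mk ((⋃ p ∈ ξ ×ˢ ξ, bad p) ∪ (F ∪ ξ) : Set G) < Cardinal.mk G :=
    (Cardinal.mk_union_le _ _).trans_lt (Cardinal.add_lt_of_lt hinf
      (mk_biUnion_lt hinf (hfin.prod hfin) hbad)
      ((hF.union hfin).lt_aleph0.trans_le hinf))
  obtain ⟨x, hx⟩ : ∃ x, x ∉ (⋃ p ∈ ξ ×ˢ ξ, bad p) ∪ (F ∪ ξ) := by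
    by_contra! h
    rw [Set.eq_univ_of_forall h, Cardinal.mk_univ] at hlt
    exact hlt.false
  simp only [Set.mem_union, not_or, Set.mem_iUnion, not_exists, Set.mem_prod, bad, Prod.forall,
    Set.mem_ofPred_eq] at hx
  obtain ⟨hgood, hxF, hxξ⟩ := hx
  refine ⟨x, hxF, hxξ, Set.mem_insert_of_mem _ hξ.one_mem, ?_⟩
  -- All-new triples reduce to `σ 1 1 ≠ 0`, all-old ones to admissibility of `ξ`; the six mixed
  -- cases are the exclusions in `bad`.
  rintro a (rfl | ha) b (rfl | hb) c (rfl | hc)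
  · simpa using h11
  · exact (hgood c c ⟨hc, hc⟩).1.1.1.1.1
  · exact (hgood b b ⟨hb, hb⟩).1.1.1.1.2
  · exact (hgood b c ⟨hb, hc⟩).1.1.2
  · exact (hgood a a ⟨ha, ha⟩).1.1.1.2
  · exact (hgood a c ⟨ha, hc⟩).1.2
  · exact (hgood a b ⟨ha, hb⟩).2
  · exact hξ.ne_zero a ha b hb c hc

/-- An admissible set can be changed at exactly one point, outside a given finite set, such that
it stays admissible. -/
theorem IsAdmissible.exists_perturbation [Infinite G] {σ : G → G → κ} (h11 : σ 1 1 ≠ 0)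
    (hcard : Cardinal.mk (Null σ) < Cardinal.mk G) {ξ : Set G} (hξ : IsAdmissible σ ξ)
    {F : Set G} (hF : F.Finite) :
    ∃ η, IsAdmissible σ η ∧ ∃ x, x ∉ F ∧ ∀ y, (y ∈ η ↔ y ∈ ξ) ↔ y ≠ x := by
  by_cases hfin : ξ.Finite
  · obtain ⟨x, hxF, hxξ, hη⟩ := hξ.exists_insert h11 hcard hfin hF
    refine ⟨_, hη, x, hxF, fun y => ?_⟩
    by_cases hy : y = x
    · simp [hy, hxξ]
    · simp [hy]
  -- An infinite `ξ` has a point outside `F` other than `1`. The point `1` must stay; removing any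
  -- other point only drops conditions.
  · obtain ⟨x, hxξ, hx⟩ := Set.Infinite.exists_notMem_finite hfin (hF.insert 1)
    have hx1 : 1 ≠ x := fun h => hx (h ▸ Set.mem_insert _ _)
    refine ⟨ξ \ {x}, ⟨⟨hξ.one_mem, hx1⟩, fun a ha b hb c hc => hξ.ne_zero a ha.1 b hb.1 c hc.1⟩,
      x, fun h => hx (Set.mem_insert_of_mem _ h), fun y => ?_⟩
    by_cases hy : y = x
    · simp [hy, hxξ]
    · simp [hy]

end Admissible

/-! ### The space `Ω_σ` and its lack of isolated points -/

section OmegaSigma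

variable {κ : Type u} [Field κ] {G : Type v} [Group G]

/-- The generators of `I_σ` of the first kind express admissibility. Those of the second kind add
nothing for idempotent `σ`: if all four points lie in an admissible `ξ`, the four values of `σ`
involved are nonzero, hence equal to `1`, and the cocycle identity holds. -/
theorem mem_omegaSigma_iff {σ : G → G → κ} (h01 : ∀ g h, σ g h = 0 ∨ σ g h = 1) (ξ : Omega G) :
    ξ ∈ OmegaSigma σ ↔ IsAdmissible σ ξ.1 := by
  have hval : ∀ g, pointHom κ ξ (diagIdem (trivialFactorSet κ G) g) = 0 ↔ g ∉ ξ.1 := fun g => by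
    rw [pointHom_diagIdem]
    split_ifs with h <;> simp [h]
  change sigmaIdeal σ ≤ _ ↔ _
  rw [sigmaIdeal, Ideal.span_le]
  constructor
  -- With `s = a`, `g = a⁻¹ * b`, `h = b⁻¹ * c` the points `s`, `s * g`, `s * g * h` are `a`, `b`,
  -- `c`.
  · refine fun H => ⟨ξ.2, fun a ha b hb c hc h0 => ?_⟩
    have := H (Or.inl ⟨a, a⁻¹ * b, b⁻¹ * c, h0, rfl⟩)
    simp only [SetLike.mem_coe, RingHom.mem_ker, map_mul, mul_eq_zero, hval] at this
    simp [ha, hb, hc] at this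
  · rintro hξ b (⟨s, g, h, h0, rfl⟩ | ⟨s, g, h, t, hne, rfl⟩)
    · simp only [SetLike.mem_coe, RingHom.mem_ker, map_mul, mul_eq_zero, hval]
      by_contra! hmem
      exact hξ.ne_zero_of_mem hmem.1.1 hmem.1.2 hmem.2 h0
    · simp only [SetLike.mem_coe, RingHom.mem_ker, map_mul, mul_eq_zero, hval]
      by_contra! hmem
      obtain ⟨⟨⟨h1, h2⟩, h3⟩, h4⟩ := hmem
      have hone : ∀ {g h}, σ g h ≠ 0 → σ g h = 1 := fun hn => (h01 _ _).resolve_left hn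
      apply hne
      rw [hone (hξ.ne_zero_of_mem h1 h2 h3), hone (hξ.ne_zero_of_mem h2 h3 h4),
        hone (hξ.ne_zero_of_mem h1 (by rwa [← mul_assoc]) (by rwa [← mul_assoc])),
        hone (hξ.ne_zero_of_mem h1 h2 (by rwa [← mul_assoc]))]

theorem exists_finite_of_isOpen_omega {U : Set (Omega G)} (hU : IsOpen U) {ξ : Omega G}
    (hξ : ξ ∈ U) : ∃ F : Set G, F.Finite ∧ ∀ η : Omega G, (∀ g ∈ F, g ∈ η.1 ↔ g ∈ ξ.1) → η ∈ U := by
  obtain ⟨V, hV, rfl⟩ := isOpen_induced_iff.1 hU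
  obtain ⟨I, u, hu, hsub⟩ := isOpen_pi_iff.1 hV _ hξ
  refine ⟨I, I.finite_toSet, fun η hη => hsub fun g hg => ?_⟩
  convert (hu g hg).2 using 1
  exact decide_eq_decide.2 (hη g hg)

theorem not_isOpen_singleton_omegaSigma [Infinite G] {σ : G → G → κ}
    (hσ : IsIdempotentFactorSet σ) (hcard : Cardinal.mk (Null σ) < Cardinal.mk G)
    (ξ : OmegaSigma σ) : ¬ IsOpen ({ξ} : Set (OmegaSigma σ)) := by
  intro hopen
  obtain ⟨U, hU, hUξ⟩ := isOpen_induced_iff.1 hopen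
  have hmem : ξ.1 ∈ U := by
    change ξ ∈ Subtype.val ⁻¹' U
    rw [hUξ]
    rfl
  obtain ⟨F, hF, hFU⟩ := exists_finite_of_isOpen_omega hU hmem
  obtain ⟨η, hη, x, hx, hxy⟩ := ((mem_omegaSigma_iff hσ.2 ξ.1).1 ξ.2).exists_perturbation
    hσ.1.one_one_ne_zero hcard hF
  let η' : OmegaSigma σ := ⟨⟨η, hη.one_mem⟩, (mem_omegaSigma_iff hσ.2 _).2 hη⟩
  have h1 : η' ∈ Subtype.val ⁻¹' U :=
    hFU _ fun g hg => (hxy g).2 fun h => hx (h ▸ hg)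
  rw [hUξ] at h1
  have h2 : η = ξ.1.1 := congrArg (fun ζ : OmegaSigma σ => ζ.1.1) h1
  exact (hxy x).1 (by rw [h2]) rfl

end OmegaSigma

/-! ### Characters of `B^σ` with prescribed admissible support -/

section Realization

variable {κ : Type u} [Field κ] {G : Type v} [Group G] {σ : G → G → κ}

/-- With `s = x⁻¹`, the value of the composite at `x` can be nonzero only if `s`, `s * g` and `s * g
* h` all lie in `ξ`. -/
theorem shift_mul_shift_eq_zero {ξ : Set G} {g h : G}
    (H : ∀ s, s ∈ ξ → s * g ∈ ξ → s * g * h ∉ ξ) : shift κ ξ g * shift κ ξ h = 0 := by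
  ext φ x
  rw [Module.End.mul_apply]
  by_cases h1 : (g⁻¹ * x.1)⁻¹ ∈ ξ
  · rw [shift_apply_of_mem κ _ _ h1]
    refine shift_apply_of_not_mem κ _ _ fun h2 => H x.1⁻¹ x.2 (by simpa using h1) ?_
    simpa [mul_assoc] using h2
  · exact shift_apply_of_not_mem κ _ _ h1

theorem IsAdmissible.shift_zero_left {ξ : Set G} (hξ : IsAdmissible σ ξ) (g h : G)
    (h0 : σ g h = 0) : shift κ ξ g⁻¹ * shift κ ξ (g * h) = 0 :=
  shift_mul_shift_eq_zero fun s h1 h2 h3 =>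
    hξ.ne_zero_of_mem h2 (by simpa using h1) (by simpa [mul_assoc] using h3) h0

theorem IsAdmissible.shift_zero_right {ξ : Set G} (hξ : IsAdmissible σ ξ) (g h : G)
    (h0 : σ g h = 0) : shift κ ξ (g * h) * shift κ ξ h⁻¹ = 0 :=
  shift_mul_shift_eq_zero fun s h1 h2 h3 =>
    hξ.ne_zero_of_mem h1 (by simpa [mul_assoc] using h3) (by simpa [mul_assoc] using h2) h0

/-- The action of the twisted partial group algebra on the functions on `ξ⁻¹` for an admissible
set `ξ`. -/
noncomputable def admissibleHom (h01 : ∀ g h, σ g h = 0 ∨ σ g h = 1) {ξ : Set G}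
    (hξ : IsAdmissible σ ξ) : TwistedAlg σ →ₐ[κ] Module.End κ ({x : G // x⁻¹ ∈ ξ} → κ) :=
  liftAlg σ (shift κ ξ) hξ.shift_zero_left hξ.shift_zero_right (shift_one κ ξ)
    (fun g h => by
      rw [shift_mul_left]
      rcases h01 g h with h0 | h1
      · rw [hξ.shift_zero_left g h h0, smul_zero]
      · rw [h1, one_smul])
    (fun g h => by
      rw [shift_mul_right]
      rcases h01 g h with h0 | h1
      · rw [hξ.shift_zero_right g h h0, smul_zero]
      · rw [h1, one_smul])

theorem admissibleHom_idem_apply (h01 : ∀ g h, σ g h = 0 ∨ σ g h = 1) {ξ : Set G}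
    (hξ : IsAdmissible σ ξ) (g : G) (φ : {x : G // x⁻¹ ∈ ξ} → κ) (x : {x : G // x⁻¹ ∈ ξ}) :
    admissibleHom h01 hξ (idem σ g) φ x =
      (open Classical in if (g⁻¹ * x.1)⁻¹ ∈ ξ then 1 else 0) * φ x := by
  rw [idem_eq, map_smul, map_mul, admissibleHom, liftAlg_br, liftAlg_br, LinearMap.smul_apply,
    Pi.smul_apply, Module.End.mul_apply]
  by_cases h : (g⁻¹ * x.1)⁻¹ ∈ ξ
  · have e : g⁻¹⁻¹ * (g⁻¹ * x.1) = x.1 := by group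
    -- For `s = x⁻¹` the triple is `s`, `s * g`, `s`. Thus the normalizing scalar is `1` wherever
    -- the operator does not already vanish.
    have hne : σ g g⁻¹ ≠ 0 := hξ.ne_zero_of_mem (s := x.1⁻¹) x.2 (by simpa using h)
      (by simpa using x.2)
    rw [shift_apply_of_mem κ _ _ h, shift_apply_of_mem κ _ _ (by rw [e]; exact x.2), if_pos h,
      (h01 _ _).resolve_left hne, inv_one, one_smul, one_mul]
    congr 1
    exact Subtype.ext e
  · rw [shift_apply_of_not_mem κ _ _ h, if_neg h, zero_mul, smul_zero]

/-- Elements of `B^σ` act as multiplication operators. This makes evaluating `b · 1` at a fixed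
point multiplicative in `b`. -/
theorem admissibleHom_diag (h01 : ∀ g h, σ g h = 0 ∨ σ g h = 1) {ξ : Set G}
    (hξ : IsAdmissible σ ξ) {b : TwistedAlg σ} (hb : b ∈ diagAlg σ) :
    ∃ d : {x : G // x⁻¹ ∈ ξ} → κ, ∀ φ x, admissibleHom h01 hξ b φ x = d x * φ x := by
  unfold diagAlg at hb
  induction hb using Algebra.adjoin_induction with
  | mem b hb =>
    obtain ⟨g, rfl⟩ := hb
    exact ⟨_, fun φ x => admissibleHom_idem_apply h01 hξ g φ x⟩
  | algebraMap r =>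
    exact ⟨fun _ => r, fun φ x => by rw [AlgHom.commutes, Module.algebraMap_end_apply]; rfl⟩
  | add a b _ _ ha hb =>
    obtain ⟨d, hd⟩ := ha
    obtain ⟨d', hd'⟩ := hb
    exact ⟨d + d', fun φ x => by
      rw [map_add, LinearMap.add_apply, Pi.add_apply, hd, hd', Pi.add_apply, add_mul]⟩
  | mul a b _ _ ha hb =>
    obtain ⟨d, hd⟩ := ha
    obtain ⟨d', hd'⟩ := hb
    exact ⟨d * d', fun φ x => by
      rw [map_mul, Module.End.mul_apply, hd, hd', Pi.mul_apply, mul_assoc]⟩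

/-- Every admissible set is the support of a character of `B^σ`. -/
theorem IsAdmissible.exists_spectrum (h01 : ∀ g h, σ g h = 0 ∨ σ g h = 1) {ξ : Set G}
    (hξ : IsAdmissible σ ξ) : ∃ f : Spectrum σ, ∀ g,
      f (diagIdem σ g) = (open Classical in if g ∈ ξ then 1 else 0) := by
  have h1 : (1 : G)⁻¹ ∈ ξ := by rw [inv_one]; exact hξ.one_mem
  -- The character sends `b` to the value of `b · 1` at the neutral element, as for `pointHom`.
  refine ⟨show diagAlg σ →ₐ[κ] κ from AlgHom.ofLinearMap
    { toFun := fun b => admissibleHom h01 hξ b.1 (fun _ => 1) ⟨1, h1⟩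
      map_add' := fun a b => by simp
      map_smul' := fun c b => by simp }
    (by simp)
    (fun a b => by
      obtain ⟨d, hd⟩ := admissibleHom_diag h01 hξ a.2
      simp only [LinearMap.coe_mk, AddHom.coe_mk, Subalgebra.coe_mul, map_mul,
        Module.End.mul_apply]
      rw [hd, hd, mul_one]), fun g => ?_⟩
  refine (admissibleHom_idem_apply h01 hξ g _ _).trans ?_
  have e : (g⁻¹ * (1 : G))⁻¹ = g := by group
  rw [mul_one]
  congr 1
  exact congrArg (· ∈ ξ) e

end Realization

/-! ### Supports of characters and topological freeness -/

section Support

variable {κ : Type u} [Field κ] {G : Type v} [Group G] {σ : G → G → κ}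

/-- The support of a character of `B^σ`. -/
def Spectrum.support (f : Spectrum σ) : Set G := {g | f (diagIdem σ g) = 1}

theorem Spectrum.diagIdem_eq_zero_or_one (f : Spectrum σ) (g : G) :
    f (diagIdem σ g) = 0 ∨ f (diagIdem σ g) = 1 := by
  have h : diagIdem σ g * diagIdem σ g = diagIdem σ g := Subtype.ext (idem_mul_self σ g)
  have h2 := congrArg f h
  rw [map_mul] at h2
  exact IsIdempotentElem.iff_eq_zero_or_one.1 h2

/-- Since `e_g` is idempotent, `f (e_g)` is `0` or `1`, so the support records it completely. -/
theorem Spectrum.diagIdem_eq_of_mem_support_iff {f f' : Spectrum σ} {g : G}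
    (h : g ∈ f.support ↔ g ∈ f'.support) : f (diagIdem σ g) = f' (diagIdem σ g) := by
  change f _ = 1 ↔ f' _ = 1 at h
  rcases f.diagIdem_eq_zero_or_one g with h0 | h0 <;>
    rcases f'.diagIdem_eq_zero_or_one g with h1 | h1 <;> simp_all

theorem diagIdem_mul_diagIdem_mul {g h : G} (h0 : σ g h = 0) :
    diagIdem σ g * diagIdem σ (g * h) = 0 := by
  apply Subtype.ext
  change idem σ g * idem σ (g * h) = 0
  rw [idem_eq, idem_eq, smul_mul_smul_comm, mul_assoc, ← mul_assoc (br σ g⁻¹),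
    br_zero_left σ g h h0, zero_mul, mul_zero, smul_zero]

/-- If `σ g h = 0`, the relation `[g⁻¹][gh] = 0` yields `e_g e_{gh} = 0`. Conjugation by `[a]`
translates this to `e_a e_{ag} e_{agh} = 0`, and with `g = a⁻¹ * b`, `h = b⁻¹ * c` to `e_a e_b e_c =
0`. A character cannot take the value `1` on all three factors. -/
theorem Spectrum.isAdmissible_support (f : Spectrum σ) : IsAdmissible σ f.support := by
  refine ⟨map_diagIdem_one σ f, fun a ha b hb c hc h0 => ?_⟩
  have h := congrArg (fun x => f (conj σ a x)) (diagIdem_mul_diagIdem_mul h0)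
  have hz : conj σ a 0 = 0 := Subtype.ext (by rw [conj_coe]; simp)
  have ha' : f (diagIdem σ a) = 1 := ha
  have hb' : f (diagIdem σ b) = 1 := hb
  have hc' : f (diagIdem σ c) = 1 := hc
  have e : a * (a⁻¹ * b * (b⁻¹ * c)) = c := by group
  simp only [conj_mul, conj_idem, map_mul, hz, map_zero, mul_inv_cancel_left, e, ha', hb', hc',
    mul_one, one_ne_zero] at h

theorem Spectrum.mem_support_specMap (g h : G) (f : Spectrum σ) (hf : f ∈ specDom σ g⁻¹) :
    h ∈ Spectrum.support (specMap σ g f hf) ↔ g⁻¹ * h ∈ f.support := by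
  change specMap σ g f hf (diagIdem σ h) = 1 ↔ _
  rw [specMap_idem]
  rfl

/-- Each element of `B^σ` is a polynomial in finitely many of the `e_g`. Hence pointwise convergence
on `B^σ` is controlled by finite pieces of the supports. -/
theorem exists_finite_determining (x : diagAlg σ) : ∃ F : Set G, F.Finite ∧
    ∀ f f' : Spectrum σ, (∀ g ∈ F, f (diagIdem σ g) = f' (diagIdem σ g)) → f x = f' x := by
  obtain ⟨x, hx⟩ := x
  induction hx using Algebra.adjoin_induction with
  | mem x hx =>
    obtain ⟨g, rfl⟩ := hx
    exact ⟨{g}, Set.finite_singleton g, fun f f' h => h g rfl⟩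
  | algebraMap r =>
    exact ⟨∅, Set.finite_empty, fun f f' _ =>
      (AlgHomClass.commutes f r).trans (AlgHomClass.commutes f' r).symm⟩
  | add x y hx hy ihx ihy =>
    obtain ⟨F, hF, h⟩ := ihx
    obtain ⟨F', hF', h'⟩ := ihy
    refine ⟨F ∪ F', hF.union hF', fun f f' H => ?_⟩
    change f (⟨x, hx⟩ + ⟨y, hy⟩ : diagAlg σ) = f' (⟨x, hx⟩ + ⟨y, hy⟩ : diagAlg σ)
    rw [map_add, map_add, h f f' fun g hg => H g (Or.inl hg),
      h' f f' fun g hg => H g (Or.inr hg)]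
  | mul x y hx hy ihx ihy =>
    obtain ⟨F, hF, h⟩ := ihx
    obtain ⟨F', hF', h'⟩ := ihy
    refine ⟨F ∪ F', hF.union hF', fun f f' H => ?_⟩
    change f (⟨x, hx⟩ * ⟨y, hy⟩ : diagAlg σ) = f' (⟨x, hx⟩ * ⟨y, hy⟩ : diagAlg σ)
    rw [map_mul, map_mul, h f f' fun g hg => H g (Or.inl hg),
      h' f f' fun g hg => H g (Or.inr hg)]

theorem exists_finite_of_isOpen_spectrum {U : Set (Spectrum σ)} (hU : IsOpen U) {f : Spectrum σ}
    (hf : f ∈ U) : ∃ F : Set G, F.Finite ∧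
      ∀ f' : Spectrum σ, (∀ g ∈ F, g ∈ f'.support ↔ g ∈ f.support) → f' ∈ U := by
  let _ : TopologicalSpace κ := ⊥
  obtain ⟨V, hV, rfl⟩ := isOpen_induced_iff.1 hU
  obtain ⟨I, u, hu, hsub⟩ := isOpen_pi_iff.1 hV _ hf
  choose F hF hdet using exists_finite_determining (σ := σ)
  refine ⟨⋃ x ∈ I, F x, I.finite_toSet.biUnion fun x _ => hF x, fun f' h => hsub fun x hx => ?_⟩
  have : f' x = f x := hdet x f' f fun g hg =>
    Spectrum.diagIdem_eq_of_mem_support_iff (h g (Set.mem_biUnion hx hg))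
  change f' x ∈ u x
  rw [this]
  exact (hu x hx).2

/-- The map `θ̂_g` translates supports by `g` on the left, so the support of a fixed point is
invariant under this translation. -/
theorem Spectrum.mem_support_iff_of_mem_fix {g : G} {f : Spectrum σ}
    (hf : f ∈ (spectralAction σ).fix g) (h : G) : g * h ∈ f.support ↔ h ∈ f.support := by
  obtain ⟨hd, hfix⟩ := hf
  have h1 : specMap σ g f hd = f := hfix
  have h2 := Spectrum.mem_support_specMap g (g * h) f hd
  rwa [h1, inv_mul_cancel_left] at h2

theorem isTopologicallyFree_spectralAction [Infinite G] (hσ : IsIdempotentFactorSet σ)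
    (hcard : Cardinal.mk (Null σ) < Cardinal.mk G) :
    (spectralAction σ).IsTopologicallyFree := by
  intro g hg
  refine Set.eq_empty_of_forall_notMem fun f hf => ?_
  obtain ⟨F, hF, hFU⟩ := exists_finite_of_isOpen_spectrum isOpen_interior hf
  obtain ⟨η, hη, x, hx, hxy⟩ := f.isAdmissible_support.exists_perturbation
    hσ.1.one_one_ne_zero hcard hF
  obtain ⟨f', hf'⟩ := hη.exists_spectrum hσ.2
  have hs : ∀ y, y ∈ f'.support ↔ y ∈ η := fun y => by
    change f' _ = 1 ↔ _
    rw [hf']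
    split_ifs with h <;> simp [h]
  have hmem := hFU f' fun y hy => (hs y).trans ((hxy y).2 fun h => hx (h ▸ hy))
  have h1 := Spectrum.mem_support_iff_of_mem_fix (interior_subset hf) x
  have h2 := Spectrum.mem_support_iff_of_mem_fix (interior_subset hmem) x
  -- Since `g ≠ 1`, the point `g * x` differs from `x`, so the perturbation leaves its membership
  -- unchanged. Invariance of both supports carries this back to `x`, where membership was changed.
  have h3 := (hxy (g * x)).2 fun h => hg (mul_eq_right.1 h)
  rw [hs, hs] at h2
  exact (hxy x).1 (h2.symm.trans (h3.trans h1)) rfl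

end Support

end PartialProj

theorem mainTheorem10 {κ : Type*} [Field κ] {G : Type*} [Group G] [Infinite G]
    (σ : G → G → κ) (hσ : PartialProj.IsIdempotentFactorSet σ)
    (hcard : Cardinal.mk (PartialProj.Null σ) < Cardinal.mk G) :
    (∀ ξ : PartialProj.OmegaSigma σ, ¬ IsOpen ({ξ} : Set (PartialProj.OmegaSigma σ))) ∧
      (PartialProj.spectralAction σ).IsTopologicallyFree :=
  ⟨PartialProj.not_isOpen_singleton_omegaSigma hσ hcard,
    PartialProj.isTopologicallyFree_spectralAction hσ hcard⟩
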